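/- **Definitions.** A *labelled open graph* $(G,I,O,\lambda)$ consists of a finite simple undirected graph $G=(V,E)$, sets $I,O\subseteq V$ of inputs and outputs, and a labelling $\lambda:V\setminus O\to\{X,Y,Z,XY,XZ,YZ\}$. An *MBQC-form diagram* is a labelled open graph together with an angle $\alpha(v)\in\mathbb R$ for every $v\in V\setminus O$, where $\alpha(v)\in\{0,\pi\}$ if $\lambda(v)\in\{X,Y,Z\}$, and an ordering of its inputs and of its outputs. It is read as a ZX-diagram: each vertex is a phase-free Z-spider, each edge carries a Hadamard gate, each input vertex has an input wire, each output vertex has an output wire, and each $v\in V\setminus O$ carries instead of an output wire the measurement effect $\langle +_{\lambda(v),\alpha(v)}|$, where $|+_{XY,\alpha}\rangle=\frac1{\sqrt2}(|0\rangle+e^{i\alpha}|1\rangle)$, $|+_{XZ,\alpha}\rangle=\cos\frac\alpha2|0\rangle+\sin\frac\alpha2|1\rangle$, $|+_{YZ,\alpha}\rangle=\cos\frac\alpha2|0\rangle+i\sin\frac\alpha2|1\rangle$, $|+_{X,\alpha}\rangle=|+_{XY,\alpha}\rangle$, $|+_{Y,\alpha}\rangle=|+_{XY,\alpha+\pi/2}\rangle$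 and $|+_{Z,\alpha}\rangle=|+_{XZ,\alpha}\rangle$. Its linear map $[\![D]\!]:(\mathbb C^2)^{\otimes |I|}\to(\mathbb C^2)^{\otimes |O|}$ is the one obtained by contracting this diagram. Two diagrams $D,D'$ with equally many inputs and equally many outputs are *equivalent* if $[\![D]\!]=z[\![D']\!]$ for some $z\in\mathbb C\setminus\{0\}$. For $A\subseteq V$ let $\mathrm{Odd}_G(A)$ be the set of vertices with an odd number of neighbours in $A$. The diagram has *Pauli flow* if there are a map $p:V\setminus O\to\mathcal P(V\setminus I)$ and a strict partial order $\prec$ on $V$ such that for all $u\in V\setminus O$ and $v\in V$ (the statement "$\lambda(v)\notin S$" being regarded as true, and "$\lambda(v)=Y$" as false, when $v\in O$): 1. if $v\in p(u)$, $v\ne u$ and $\lambda(v)\notin\{X,Y\}$, then $u\prec v$; 2. if $v\in\mathrm{Odd}_G(p(u))$, $v\neq u$ and $\lambda(v)\notin\{Y,Z\}$, then $u\prec v$; 3. if $\neg(u\prec v)$, $u\ne v$ and $\lambda(v)=Y$, then $v\in p(u)\Leftrightarrow v\in\mathrm{Odd}_G(p(u))$; 4. if $\lambda(u)=XY$, then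 $u\notin p(u)$ and $u\in\mathrm{Odd}_G(p(u))$; 5. if $\lambda(u)=XZ$, then $u\in p(u)$ and $u\in\mathrm{Odd}_G(p(u))$; 6. if $\lambda(u)=YZ$, then $u\in p(u)$ and $u\notin\mathrm{Odd}_G(p(u))$; 7. if $\lambda(u)=X$, then $u\in\mathrm{Odd}_G(p(u))$; 8. if $\lambda(u)=Z$, then $u\in p(u)$; 9. if $\lambda(u)=Y$, then exactly one of $u\in p(u)$ and $u\in\mathrm{Odd}_G(p(u))$ holds. **Proposition 3.3.** Let $D=(G,I,O,\lambda)$, with its measurement angles, be an arbitrary MBQC-form diagram with Pauli flow. Then there exists an equivalent MBQC-form diagram $D'=(G',I',O',\lambda')$, with its own measurement angles, that has Pauli flow and satisfies $\lambda'(v)\in\{X,Y,XY\}$ for all $v\in V'\setminus O'$. -/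

import Mathlib

/-- The measurement labels: three planes of the Bloch sphere and three Pauli measurements. -/
inductive MeasLabel
  | X | Y | Z | XY | XZ | YZ

/-- The labels of Pauli measurements. -/
def MeasLabel.IsPauli : MeasLabel → Prop
  | X => True
  | Y => True
  | Z => True
  | XY => False
  | XZ => False
  | YZ => False

/-- The measurement effect `⟨+_{l,α}|`, as the row vector of its values on `|0⟩` and `|1⟩`.
The corresponding states are `|+_{XY,α}⟩ = (|0⟩ + e^{iα}|1⟩)/√2`,
`|+_{XZ,α}⟩ = cos(α/2)|0⟩ + sin(α/2)|1⟩`, `|+_{YZ,α}⟩ = cos(α/2)|0⟩ + i sin(α/2)|1⟩`,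
and the effects are their conjugate transposes. The Pauli effects `X`, `Y`, `Z`
at the angles `0` and `π` project onto the two eigenstates of the Pauli matrix
(for the eigenvalues `1` and `-1` respectively). -/
noncomputable def measEffect : MeasLabel → ℝ → Fin 2 → ℂ
  | .XY, α => ![1 / (√2 : ℝ), Complex.exp (-(α * Complex.I)) / (√2 : ℝ)]
  | .XZ, α => ![(Real.cos (α / 2) : ℝ), (Real.sin (α / 2) : ℝ)]
  | .YZ, α => ![(Real.cos (α / 2) : ℝ), -(Complex.I * (Real.sin (α / 2) : ℝ))]
  | .X, α => ![1 / (√2 : ℝ), Complex.exp (-(α * Complex.I)) / (√2 : ℝ)]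
  | .Y, α => ![1 / (√2 : ℝ), Complex.exp (-((α + Real.pi / 2 : ℝ) * Complex.I)) / (√2 : ℝ)]
  | .Z, α => ![(Real.cos (α / 2) : ℝ), (Real.sin (α / 2) : ℝ)]

/-- The entries of the Hadamard gate `|+⟩⟨0| + |-⟩⟨1|`. -/
noncomputable def hadamardEntry (i j : Fin 2) : ℂ :=
  (if i = 1 ∧ j = 1 then -1 else 1) / (√2 : ℝ)

theorem hadamardEntry_comm (i j : Fin 2) : hadamardEntry i j = hadamardEntry j i := by
  simp [hadamardEntry, and_comm]

/-- An MBQC-form diagram on the vertex set `V`, with `n` input wires and `m` output wires.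
Every vertex of the simple graph is a phase-free green spider and every edge carries a Hadamard
gate. `inp i` is the vertex to which the `i`-th input wire is attached, `out j` the vertex to
which the `j`-th output wire is attached; a vertex may be both. Every vertex `v` that is not an
output has in place of the output wire the measurement effect `⟨+_{label v, angle v}|`.
The values of `label` and `angle` at output vertices are never used. -/
structure MBQCDiagram (V : Type*) (n m : ℕ) where
  graph : SimpleGraph V
  inp : Fin n ↪ V
  out : Fin m ↪ V
  label : V → MeasLabel
  angle : V → ℝ
  pauli_angle : ∀ v, v ∉ Set.range out → (label v).IsPauli → angle v = 0 ∨ angle v = Real.pi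

namespace MBQCDiagram

variable {V : Type*} {n m : ℕ}

/-- The set `I` of input vertices. -/
def inputs (D : MBQCDiagram V n m) : Set V := Set.range D.inp

/-- The set `O` of output vertices. -/
def outputs (D : MBQCDiagram V n m) : Set V := Set.range D.out

/-- `v` is a non-output vertex and its measurement label is `l`. -/
def HasLabel (D : MBQCDiagram V n m) (v : V) (l : MeasLabel) : Prop :=
  v ∉ D.outputs ∧ D.label v = l

open Classical in
/-- The odd neighbourhood of `A`: the vertices with an odd number of neighbours in `A`. -/
noncomputable def oddNbhd (D : MBQCDiagram V n m) (A : Finset V) : Set V :=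
  {v | Odd (A.filter (fun w => D.graph.Adj v w)).card}

/-- `(p, prec)` is a Pauli flow. The function `p` matters only on non-outputs, and `prec` is a
strict partial order. An output has no label, so a hypothesis "the label of `v` is not one of ..."
holds for every output `v`. -/
structure IsPauliFlow (D : MBQCDiagram V n m) (p : V → Finset V) (prec : V → V → Prop) :
    Prop where
  irrefl : ∀ u, ¬ prec u u
  trans : ∀ u v w, prec u v → prec v w → prec u w
  not_input : ∀ u, u ∉ D.outputs → ∀ v ∈ p u, v ∉ D.inputs
  cond1 : ∀ u, u ∉ D.outputs → ∀ v, v ∈ p u → v ≠ u →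
    ¬ (D.HasLabel v .X ∨ D.HasLabel v .Y) → prec u v
  cond2 : ∀ u, u ∉ D.outputs → ∀ v, v ∈ D.oddNbhd (p u) → v ≠ u →
    ¬ (D.HasLabel v .Y ∨ D.HasLabel v .Z) → prec u v
  cond3 : ∀ u, u ∉ D.outputs → ∀ v, ¬ prec u v → u ≠ v → D.HasLabel v .Y →
    (v ∈ p u ↔ v ∈ D.oddNbhd (p u))
  cond4 : ∀ u, D.HasLabel u .XY → u ∉ p u ∧ u ∈ D.oddNbhd (p u)
  cond5 : ∀ u, D.HasLabel u .XZ → u ∈ p u ∧ u ∈ D.oddNbhd (p u)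
  cond6 : ∀ u, D.HasLabel u .YZ → u ∈ p u ∧ u ∉ D.oddNbhd (p u)
  cond7 : ∀ u, D.HasLabel u .X → u ∈ D.oddNbhd (p u)
  cond8 : ∀ u, D.HasLabel u .Z → u ∈ p u
  cond9 : ∀ u, D.HasLabel u .Y →
    (u ∈ p u ∧ u ∉ D.oddNbhd (p u)) ∨ (u ∉ p u ∧ u ∈ D.oddNbhd (p u))

/-- The diagram has Pauli flow. -/
def HasPauliFlow (D : MBQCDiagram V n m) : Prop :=
  ∃ (p : V → Finset V) (prec : V → V → Prop), D.IsPauliFlow p prec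

open Classical in
/-- The entry `⟨y| ⟦D⟧ |x⟩` of the linear map of the diagram in the computational basis.
A phase-free green spider `|0…0⟩⟨0…0| + |1…1⟩⟨1…1|` is `1` if all its legs carry the same basis
value and `0` otherwise, so contracting the diagram amounts to summing over one basis value `b v`
for every spider `v`, agreeing with `x` on the input wires and with `y` on the output wires, the
product of the entries of the Hadamard gates on the edges and of the measurement effects. -/
noncomputable def amplitude [Fintype V] (D : MBQCDiagram V n m)
    (y : Fin m → Fin 2) (x : Fin n → Fin 2) : ℂ :=
  ∑ b : V → Fin 2,
    if (∀ i, b (D.inp i) = x i) ∧ (∀ j, b (D.out j) = y j) then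
      (∏ e ∈ D.graph.edgeFinset,
        Sym2.lift ⟨fun u v => hadamardEntry (b u) (b v),
          fun u v => hadamardEntry_comm (b u) (b v)⟩ e) *
      ∏ v ∈ Finset.univ.filter (fun v => v ∉ D.outputs),
        measEffect (D.label v) (D.angle v) (b v)
    else 0

/-- The linear map `⟦D⟧` from `n` qubits to `m` qubits; the space of `k` qubits is the space of
complex functions on the computational basis `Fin k → Fin 2`. -/
noncomputable def interp [Fintype V] (D : MBQCDiagram V n m) :
    ((Fin n → Fin 2) → ℂ) →ₗ[ℂ] ((Fin m → Fin 2) → ℂ) :=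
  Matrix.toLin' (Matrix.of D.amplitude)

/-- Two diagrams with the same numbers of inputs and outputs are equivalent if their linear maps
agree up to a non-zero complex scalar. -/
def Equivalent {V' : Type*} [Fintype V] [Fintype V']
    (D : MBQCDiagram V n m) (D' : MBQCDiagram V' n m) : Prop :=
  ∃ z : ℂ, z ≠ 0 ∧ D.interp = z • D'.interp

end MBQCDiagram

/-!
Every measured vertex `u` labelled `XZ`, `YZ` or `Z` is replaced by a pair: `u` itself, now with a
Pauli label `X` or `Y`, and a new leaf attached to `u` by a Hadamard edge. Up to a non-zero scalar,

* `XZ` at angle `α` is `Y` at angle `π` with a leaf `XY` at angle `-α`,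
* `YZ` at angle `α` is `X` at angle `0` with a leaf `XY` at angle `-α`,
* `Z` at angle `α ∈ {0, π}` is `X` at angle `0` with a leaf `X` at angle `α`

(`exists_measEffect_eq_gadget`). As the sum over the basis values of the leaves factors over the
leaves, the linear map changes only by a scalar (`equivalent_addLeaves`).

Pauli flow survives (`IsPauliFlow.addLeaves`). A leaf inherits the correction set of its vertex
`u`: it is in the odd neighbourhood of that set because `u ∈ p u` by the flow conditions for `XZ`,
`YZ` and `Z`. The vertex `u` is corrected by its leaf alone, whose odd neighbourhood is `{u}`. The
leaf comes immediately after `u` in the order. The one obstruction is that a vertex labelled `Z` may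
lie in any odd neighbourhood, which its new label `X` does not allow; in that case its leaf, which
is also labelled `X` and hence may be in any correction set, is added to the correction set
(`extendSet`) and removes the vertex from the odd neighbourhood.
-/

/-! ### Rewriting a measurement effect with a leaf -/

namespace MeasLabel

/-- The labels `XZ`, `YZ` and `Z`, which are to be eliminated. -/
def NeedsLeaf (l : MeasLabel) : Prop := l = .XZ ∨ l = .YZ ∨ l = .Z

/-- The label of a vertex after a leaf has been attached to it (if its label requires one). -/
def spiderLabel : MeasLabel → MeasLabel
  | XZ => Y
  | YZ => X
  | Z => X
  | l => l

/-- The angle of a vertex after a leaf has been attached to it (if its label requires one). -/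
noncomputable def spiderAngle : MeasLabel → ℝ → ℝ
  | XZ, _ => Real.pi
  | YZ, _ => 0
  | Z, _ => 0
  | _, α => α

/-- The label of the leaf attached to a vertex. -/
def leafLabel : MeasLabel → MeasLabel
  | Z => X
  | _ => XY

/-- The angle of the leaf attached to a vertex. -/
def leafAngle : MeasLabel → ℝ → ℝ
  | Z, α => α
  | _, α => -α

end MeasLabel

open MeasLabel

theorem one_add_exp_mul_I (x : ℂ) :
    1 + Complex.exp (x * Complex.I) =
      2 * Complex.exp (x / 2 * Complex.I) * Complex.cos (x / 2) := by
  have h : Complex.exp (x * Complex.I) = Complex.exp (x / 2 * Complex.I) ^ 2 := by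
    rw [← Complex.exp_nat_mul]; congr 1; push_cast; ring
  have h2 := Complex.cos_sq_add_sin_sq (x / 2)
  rw [h, Complex.exp_mul_I]
  linear_combination -h2 + Complex.sin (x / 2) ^ 2 * Complex.I_sq

theorem one_sub_exp_mul_I (x : ℂ) :
    1 - Complex.exp (x * Complex.I) =
      -(2 * Complex.exp (x / 2 * Complex.I) * (Complex.I * Complex.sin (x / 2))) := by
  have h : Complex.exp (x * Complex.I) = Complex.exp (x / 2 * Complex.I) ^ 2 := by
    rw [← Complex.exp_nat_mul]; congr 1; push_cast; ring
  have h2 := Complex.cos_sq_add_sin_sq (x / 2)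
  rw [h, Complex.exp_mul_I]
  linear_combination -h2 + Complex.sin (x / 2) ^ 2 * Complex.I_sq

/-- A vertex with a leaf realizes, up to a non-zero scalar, the effect of the original label. The
angle must be `0` or `π` in the case of `Z`. -/
theorem exists_measEffect_eq_gadget {l : MeasLabel} (hl : l.NeedsLeaf) {α : ℝ}
    (hα : l.IsPauli → α = 0 ∨ α = Real.pi) :
    ∃ z : ℂ, z ≠ 0 ∧ ∀ b, measEffect l.spiderLabel (l.spiderAngle α) b *
      ∑ c, hadamardEntry b c * measEffect l.leafLabel (l.leafAngle α) c =
        z * measEffect l α b := by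
  have hs : ((√2 : ℝ) : ℂ) ≠ 0 := by
    norm_num [Complex.ofReal_eq_zero]
  have hs2 : ((√2 : ℝ) : ℂ) ^ 2 = 2 := by
    rw [← Complex.ofReal_pow, Real.sq_sqrt (by norm_num)]; norm_num
  have h1 := one_add_exp_mul_I α
  have h2 := one_sub_exp_mul_I α
  rcases hl with rfl | rfl | rfl
  -- The label `Y` at angle `π` supplies the relative phase `I` that turns a `YZ` effect into `XZ`.
  · have h3 : Complex.exp (-((Real.pi + Real.pi / 2) * Complex.I)) = Complex.I := by
      rw [show -(((Real.pi : ℂ) + Real.pi / 2) * Complex.I)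
        = Real.pi / 2 * Complex.I - 2 * Real.pi * Complex.I by ring, Complex.exp_sub,
        Complex.exp_pi_div_two_mul_I, Complex.exp_two_pi_mul_I, div_one]
    refine ⟨Complex.exp (α / 2 * Complex.I) / (√2 : ℝ), div_ne_zero (Complex.exp_ne_zero _) hs,
      fun b => ?_⟩
    fin_cases b
    · simp [measEffect, spiderLabel, spiderAngle, leafLabel, leafAngle, hadamardEntry,
        Fin.sum_univ_two]
      generalize Complex.exp (α / 2 * Complex.I) = E at h1 h2 ⊢
      generalize Complex.exp (α * Complex.I) = F at h1 h2 ⊢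
      field_simp
      rw [hs2]
      linear_combination h1
    · simp [measEffect, spiderLabel, spiderAngle, leafLabel, leafAngle, hadamardEntry,
        Fin.sum_univ_two, h3]
      generalize Complex.exp (α / 2 * Complex.I) = E at h1 h2 ⊢
      generalize Complex.exp (α * Complex.I) = F at h1 h2 ⊢
      field_simp
      rw [hs2]
      linear_combination Complex.I * h2 -
        2 * E * Complex.sin (α / 2) * Complex.I_sq
  · refine ⟨Complex.exp (α / 2 * Complex.I) / (√2 : ℝ), div_ne_zero (Complex.exp_ne_zero _) hs,
      fun b => ?_⟩
    fin_cases b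
    · simp [measEffect, spiderLabel, spiderAngle, leafLabel, leafAngle, hadamardEntry,
        Fin.sum_univ_two]
      generalize Complex.exp (α / 2 * Complex.I) = E at h1 h2 ⊢
      generalize Complex.exp (α * Complex.I) = F at h1 h2 ⊢
      field_simp
      rw [hs2]
      linear_combination h1
    · simp [measEffect, spiderLabel, spiderAngle, leafLabel, leafAngle, hadamardEntry,
        Fin.sum_univ_two]
      generalize Complex.exp (α / 2 * Complex.I) = E at h1 h2 ⊢
      generalize Complex.exp (α * Complex.I) = F at h1 h2 ⊢
      field_simp
      rw [hs2]
      linear_combination h2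
  · refine ⟨1 / (√2 : ℝ), div_ne_zero one_ne_zero hs, fun b => ?_⟩
    rcases hα trivial with rfl | rfl <;> fin_cases b <;>
      simp [measEffect, spiderLabel, spiderAngle, leafLabel, leafAngle, hadamardEntry,
        Fin.sum_univ_two, Complex.exp_neg] <;> field_simp <;> simp [hs2] <;> norm_num

/-! ### Products of Hadamard entries over edges -/

/-- The entry of the Hadamard gate on the edge `e`, for the basis values `b` of the spiders. -/
noncomputable def hadamardWeight {W : Type*} (b : W → Fin 2) : Sym2 W → ℂ :=
  Sym2.lift ⟨fun u v => hadamardEntry (b u) (b v), fun u v => hadamardEntry_comm (b u) (b v)⟩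

@[simp]
theorem hadamardWeight_mk {W : Type*} (b : W → Fin 2) (u v : W) :
    hadamardWeight b s(u, v) = hadamardEntry (b u) (b v) := rfl

theorem hadamardWeight_map {V W : Type*} (f : V → W) (b : W → Fin 2) (e : Sym2 V) :
    hadamardWeight b (e.map f) = hadamardWeight (b ∘ f) e := by
  induction e with | _ u v => rfl

namespace MBQCDiagram

variable {V W : Type*} {n m : ℕ}

open Classical in
theorem amplitude_eq [Fintype V] [DecidableEq V] (D : MBQCDiagram V n m)
    (y : Fin m → Fin 2) (x : Fin n → Fin 2) :
    D.amplitude y x = ∑ b : V → Fin 2,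
      if (∀ i, b (D.inp i) = x i) ∧ (∀ j, b (D.out j) = y j) then
        (∏ e ∈ D.graph.edgeFinset, hadamardWeight b e) *
          ∏ v, if v ∉ D.outputs then measEffect (D.label v) (D.angle v) (b v) else 1
      else 0 := by
  simp only [amplitude, Finset.prod_filter]
  congr!

theorem equivalent_of_amplitude [Fintype V] [Fintype W] {D : MBQCDiagram V n m}
    {D' : MBQCDiagram W n m} {z : ℂ} (hz : z ≠ 0)
    (h : ∀ y x, D'.amplitude y x = z * D.amplitude y x) : D.Equivalent D' := by
  refine ⟨z⁻¹, inv_ne_zero hz, ?_⟩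
  rw [interp, interp, ← map_smul]
  congr 1
  ext y x
  simp [h, hz]

theorem Equivalent.trans {U : Type*} [Fintype U] [Fintype V] [Fintype W] {D : MBQCDiagram U n m}
    {D' : MBQCDiagram V n m} {D'' : MBQCDiagram W n m} (h : D.Equivalent D')
    (h' : D'.Equivalent D'') : D.Equivalent D'' := by
  obtain ⟨z, hz, h⟩ := h
  obtain ⟨w, hw, h'⟩ := h'
  exact ⟨z * w, mul_ne_zero hz hw, by rw [h, h', smul_smul]⟩

/-! ### Renaming the vertices -/

/-- The diagram obtained by renaming the vertices along a bijection. -/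
def reindex (D : MBQCDiagram V n m) (e : V ≃ W) : MBQCDiagram W n m where
  graph := D.graph.comap e.symm
  inp := D.inp.trans e.toEmbedding
  out := D.out.trans e.toEmbedding
  label w := D.label (e.symm w)
  angle w := D.angle (e.symm w)
  pauli_angle w hw := D.pauli_angle _ fun ⟨j, hj⟩ => hw ⟨j, by simp [hj]⟩

theorem mem_outputs_reindex (D : MBQCDiagram V n m) (e : V ≃ W) (w : W) :
    w ∈ (D.reindex e).outputs ↔ e.symm w ∈ D.outputs := by
  simp [outputs, reindex, Equiv.eq_symm_apply]

theorem mem_inputs_reindex (D : MBQCDiagram V n m) (e : V ≃ W) (w : W) :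
    w ∈ (D.reindex e).inputs ↔ e.symm w ∈ D.inputs := by
  simp [inputs, reindex, Equiv.eq_symm_apply]

theorem hasLabel_reindex (D : MBQCDiagram V n m) (e : V ≃ W) (w : W) (l : MeasLabel) :
    (D.reindex e).HasLabel w l ↔ D.HasLabel (e.symm w) l := by
  rw [HasLabel, HasLabel, mem_outputs_reindex]
  rfl

theorem mem_oddNbhd_reindex (D : MBQCDiagram V n m) (e : V ≃ W) (A : Finset V) (w : W) :
    w ∈ (D.reindex e).oddNbhd (A.map e.toEmbedding) ↔ e.symm w ∈ D.oddNbhd A := by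
  classical
  simp only [oddNbhd, Set.mem_ofPred_eq]
  rw [← Finset.card_map e.toEmbedding]
  refine iff_of_eq (congrArg (fun s : Finset W => Odd s.card) ?_)
  ext v
  simp [reindex]

theorem HasPauliFlow.reindex {D : MBQCDiagram V n m} (h : D.HasPauliFlow) (e : V ≃ W) :
    (D.reindex e).HasPauliFlow := by
  obtain ⟨p, prec, h⟩ := h
  refine ⟨fun w => (p (e.symm w)).map e.toEmbedding, fun u v => prec (e.symm u) (e.symm v), ?_⟩
  refine ⟨fun u => h.irrefl _, fun u v w => h.trans _ _ _, ?_, ?_, ?_, ?_, ?_, ?_, ?_, ?_, ?_, ?_⟩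
  all_goals
    simp only [mem_outputs_reindex, mem_inputs_reindex, hasLabel_reindex, mem_oddNbhd_reindex,
      Finset.mem_map_equiv, ne_eq, ← e.symm.injective.eq_iff]
  · exact fun u hu v => h.not_input _ hu _
  · exact fun u hu v => h.cond1 _ hu _
  · exact fun u hu v => h.cond2 _ hu _
  · exact fun u hu v => h.cond3 _ hu _
  · exact fun u => h.cond4 _
  · exact fun u => h.cond5 _
  · exact fun u => h.cond6 _
  · exact fun u => h.cond7 _
  · exact fun u => h.cond8 _
  · exact fun u => h.cond9 _

theorem equivalent_reindex [Fintype V] [Fintype W] (D : MBQCDiagram V n m) (e : V ≃ W) :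
    D.Equivalent (D.reindex e) := by
  classical
  refine equivalent_of_amplitude one_ne_zero fun y x => ?_
  rw [one_mul, amplitude_eq, amplitude_eq]
  refine Fintype.sum_equiv (e.arrowCongr (Equiv.refl _)).symm _ _ fun b => ?_
  have hedge : (D.reindex e).graph.edgeFinset = D.graph.edgeFinset.map e.toEmbedding.sym2Map := by
    ext s
    induction s with | _ u v =>
    simp only [SimpleGraph.mem_edgeFinset, SimpleGraph.mem_edgeSet, Finset.mem_map]
    constructor
    · exact fun h => ⟨s(e.symm u, e.symm v), h, by simp⟩
    · rintro ⟨s, hs, h⟩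
      have : s = s(e.symm u, e.symm v) := by
        apply e.toEmbedding.sym2Map.injective
        rw [h]; simp
      subst this
      exact hs
  rw [hedge, Finset.prod_map]
  congr 1
  congr 1
  · exact Finset.prod_congr rfl fun s _ => hadamardWeight_map e b s
  · refine Fintype.prod_equiv e.symm _ _ fun w => ?_
    simp only [mem_outputs_reindex]
    simp [MBQCDiagram.reindex]

/-! ### Attaching the leaves -/

/-- The measured vertices whose label is to be eliminated. They also serve as names of the
leaves. -/
abbrev LeafBase (D : MBQCDiagram V n m) : Type _ :=
  {v : V // v ∉ D.outputs ∧ (D.label v).NeedsLeaf}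

/-- The graph with a new leaf `Sum.inr s` attached to every vertex `s` of `D.LeafBase`. -/
def leafGraph (D : MBQCDiagram V n m) : SimpleGraph (V ⊕ D.LeafBase) where
  Adj
    | .inl u, .inl v => D.graph.Adj u v
    | .inl u, .inr s => u = s
    | .inr s, .inl v => v = s
    | .inr _, .inr _ => False
  symm := ⟨by
    rintro (u | s) (v | t) h
    exacts [h.symm, h, h, h]⟩
  loopless := ⟨by
    rintro (u | s) h
    exacts [D.graph.loopless.irrefl _ h, h]⟩

/-- The diagram in which the labels `XZ`, `YZ` and `Z` have been eliminated by means of leaves. -/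
noncomputable def addLeaves (D : MBQCDiagram V n m) : MBQCDiagram (V ⊕ D.LeafBase) n m where
  graph := D.leafGraph
  inp := D.inp.trans Function.Embedding.inl
  out := D.out.trans Function.Embedding.inl
  label := Sum.elim (fun v => (D.label v).spiderLabel) fun s => (D.label s).leafLabel
  angle := Sum.elim (fun v => (D.label v).spiderAngle (D.angle v))
    fun s => (D.label s).leafAngle (D.angle s)
  pauli_angle := by
    rintro (v | ⟨v, hv, hl⟩) h
    · have hv : v ∉ Set.range D.out := fun ⟨j, hj⟩ => h ⟨j, by simp [hj]⟩
      have := D.pauli_angle v hv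
      cases hl : D.label v <;> simp_all [spiderLabel, spiderAngle, IsPauli]
    · have := D.pauli_angle v hv
      simp only [Sum.elim_inr]
      cases hl' : D.label v <;> simp_all [leafLabel, leafAngle, IsPauli]

@[simp]
theorem inl_mem_outputs_addLeaves (D : MBQCDiagram V n m) (v : V) :
    Sum.inl v ∈ D.addLeaves.outputs ↔ v ∈ D.outputs := by
  simp [outputs, addLeaves]

@[simp]
theorem inr_notMem_outputs_addLeaves (D : MBQCDiagram V n m) (s : D.LeafBase) :
    Sum.inr s ∉ D.addLeaves.outputs := by
  simp [outputs, addLeaves]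

@[simp]
theorem label_addLeaves_inl (D : MBQCDiagram V n m) (v : V) :
    D.addLeaves.label (.inl v) = (D.label v).spiderLabel := rfl

@[simp]
theorem label_addLeaves_inr (D : MBQCDiagram V n m) (s : D.LeafBase) :
    D.addLeaves.label (.inr s) = (D.label s).leafLabel := rfl

theorem label_addLeaves (D : MBQCDiagram V n m) (v : V ⊕ D.LeafBase) :
    D.addLeaves.label v = .X ∨ D.addLeaves.label v = .Y ∨ D.addLeaves.label v = .XY := by
  rcases v with v | s
  · cases h : D.label v <;> simp [addLeaves, h, spiderLabel]
  · cases h : D.label s <;> simp [addLeaves, h, leafLabel]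

open Classical in
theorem prod_edgeFinset_addLeaves [Fintype V] (D : MBQCDiagram V n m) [Fintype D.LeafBase]
    (b : V ⊕ D.LeafBase → Fin 2) :
    ∏ e ∈ D.addLeaves.graph.edgeFinset, hadamardWeight b e =
      (∏ e ∈ D.graph.edgeFinset, hadamardWeight (b ∘ Sum.inl) e) *
        ∏ s : D.LeafBase, hadamardEntry (b (.inl s)) (b (.inr s)) := by
  have hleaf : Function.Injective fun s : D.LeafBase =>
      (s(.inl s.1, .inr s) : Sym2 (V ⊕ D.LeafBase)) := by
    intro s t h
    simpa [Subtype.ext_iff] using h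
  have hedge : D.addLeaves.graph.edgeFinset =
      D.graph.edgeFinset.map (Function.Embedding.inl : V ↪ V ⊕ D.LeafBase).sym2Map ∪
        (Finset.univ : Finset D.LeafBase).map ⟨_, hleaf⟩ := by
    ext e
    induction e with | _ u v =>
    simp only [SimpleGraph.mem_edgeFinset, SimpleGraph.mem_edgeSet, Finset.mem_union,
      Finset.mem_map]
    constructor
    · rcases u with u | s <;> rcases v with v | t <;> intro h
      · exact .inl ⟨s(u, v), h, rfl⟩
      · exact .inr ⟨t, by simp, by simp [show u = t from h]⟩
      · exact .inr ⟨s, by simp, by simp [show v = s from h]⟩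
      · exact h.elim
    · rintro (⟨e, he, h⟩ | ⟨s, -, h⟩)
      · induction e with | _ a c =>
        have he : D.graph.Adj a c := he
        have h : (s(.inl a, .inl c) : Sym2 (V ⊕ D.LeafBase)) = s(u, v) := h
        rcases Sym2.eq_iff.1 h with ⟨rfl, rfl⟩ | ⟨rfl, rfl⟩
        exacts [he, he.symm]
      · have h : (s(.inl s.1, .inr s) : Sym2 (V ⊕ D.LeafBase)) = s(u, v) := h
        rcases Sym2.eq_iff.1 h with ⟨rfl, rfl⟩ | ⟨rfl, rfl⟩
        exacts [rfl, rfl]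
  have hdisj : Disjoint
      (D.graph.edgeFinset.map (Function.Embedding.inl : V ↪ V ⊕ D.LeafBase).sym2Map)
      ((Finset.univ : Finset D.LeafBase).map ⟨_, hleaf⟩) := by
    rw [Finset.disjoint_left]
    simp only [Finset.mem_map]
    rintro _ ⟨e, -, rfl⟩ ⟨s, -, h⟩
    induction e with | _ a c =>
    have h : (s(.inl s.1, .inr s) : Sym2 (V ⊕ D.LeafBase)) = s(.inl a, .inl c) := h
    simp at h
  rw [hedge, Finset.prod_union hdisj, Finset.prod_map, Finset.prod_map]
  congr 1
  exact Finset.prod_congr rfl fun e _ => hadamardWeight_map _ b e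

theorem equivalent_addLeaves [Fintype V] (D : MBQCDiagram V n m) [Fintype D.LeafBase] :
    D.Equivalent D.addLeaves := by
  classical
  -- The original effect and the gadget differ by a non-zero scalar at each vertex separately.
  have key : ∀ v, ∃ z : ℂ, z ≠ 0 ∧ ∀ b,
      (if v ∉ D.outputs then measEffect (D.label v).spiderLabel
        ((D.label v).spiderAngle (D.angle v)) b else 1) *
      (if v ∉ D.outputs ∧ (D.label v).NeedsLeaf then ∑ c, hadamardEntry b c *
        measEffect (D.label v).leafLabel ((D.label v).leafAngle (D.angle v)) c else 1) =
      z * if v ∉ D.outputs then measEffect (D.label v) (D.angle v) b else 1 := by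
    intro v
    by_cases hv : v ∈ D.outputs
    · exact ⟨1, one_ne_zero, fun b => by simp [hv]⟩
    by_cases hl : (D.label v).NeedsLeaf
    · simpa [hv, hl] using exists_measEffect_eq_gadget hl (D.pauli_angle v hv)
    · refine ⟨1, one_ne_zero, fun b => ?_⟩
      cases h : D.label v <;> simp_all [NeedsLeaf, spiderLabel, spiderAngle]
  choose z hz key using key
  refine equivalent_of_amplitude (z := ∏ v, z v) (Finset.prod_ne_zero_iff.2 fun v _ => hz v)
    fun y x => ?_
  rw [amplitude_eq, amplitude_eq, Finset.mul_sum,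
    ← (Equiv.sumArrowEquivProdArrow V D.LeafBase (Fin 2)).symm.sum_comp, Fintype.sum_prod_type]
  refine Finset.sum_congr rfl fun b _ => ?_
  have hcond : ∀ c : D.LeafBase → Fin 2,
      (((∀ i, (Equiv.sumArrowEquivProdArrow V D.LeafBase (Fin 2)).symm (b, c)
        (D.addLeaves.inp i) = x i) ∧
      ∀ j, (Equiv.sumArrowEquivProdArrow V D.LeafBase (Fin 2)).symm (b, c)
        (D.addLeaves.out j) = y j) ↔
      (∀ i, b (D.inp i) = x i) ∧ ∀ j, b (D.out j) = y j) := fun c => Iff.rfl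
  simp only [hcond]
  by_cases hb : (∀ i, b (D.inp i) = x i) ∧ ∀ j, b (D.out j) = y j
  swap
  · simp only [if_neg hb, Finset.sum_const_zero, mul_zero]
  simp only [if_pos hb, prod_edgeFinset_addLeaves, Fintype.prod_sum_type,
    inl_mem_outputs_addLeaves, inr_notMem_outputs_addLeaves, not_false_eq_true, if_true]
  -- The sum over the basis values of the leaves is a product of one sum for each leaf.
  have hleaves : ∑ c : D.LeafBase → Fin 2, ∏ s : D.LeafBase, hadamardEntry (b s) (c s) *
      measEffect (D.label s).leafLabel ((D.label s).leafAngle (D.angle s)) (c s) =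
      ∏ v, if v ∉ D.outputs ∧ (D.label v).NeedsLeaf then ∑ c, hadamardEntry (b v) c *
        measEffect (D.label v).leafLabel ((D.label v).leafAngle (D.angle v)) c else 1 := by
    rw [← Finset.prod_filter, Finset.prod_subtype _ (p := fun v => v ∉ D.outputs ∧
      (D.label v).NeedsLeaf) (fun v => by simp), Finset.prod_univ_sum, Fintype.piFinset_univ]
  rw [mul_left_comm, ← Finset.prod_mul_distrib, Finset.prod_congr rfl fun v _ => (key v (b v)).symm,
    Finset.prod_mul_distrib, ← hleaves, Finset.mul_sum, Finset.mul_sum]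
  refine Finset.sum_congr rfl fun c _ => ?_
  rw [Finset.prod_mul_distrib]
  simp only [addLeaves, Sum.elim_inl, Sum.elim_inr, Equiv.sumArrowEquivProdArrow,
    Equiv.coe_fn_symm_mk, Function.comp_def]
  ring

/-! ### Pauli flow with leaves -/

section Flow

variable (D : MBQCDiagram V n m)

@[simp]
theorem inl_mem_inputs_addLeaves (v : V) : Sum.inl v ∈ D.addLeaves.inputs ↔ v ∈ D.inputs := by
  simp [inputs, addLeaves]

@[simp]
theorem inr_notMem_inputs_addLeaves (s : D.LeafBase) : Sum.inr s ∉ D.addLeaves.inputs := by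
  simp [inputs, addLeaves]

@[simp]
theorem hasLabel_inl_addLeaves (v : V) (l : MeasLabel) :
    D.addLeaves.HasLabel (.inl v) l ↔ v ∉ D.outputs ∧ (D.label v).spiderLabel = l := by
  rw [HasLabel, inl_mem_outputs_addLeaves]
  rfl

@[simp]
theorem hasLabel_inr_addLeaves (s : D.LeafBase) (l : MeasLabel) :
    D.addLeaves.HasLabel (.inr s) l ↔ (D.label s).leafLabel = l := by
  rw [HasLabel]
  exact and_iff_right (D.inr_notMem_outputs_addLeaves s)

/-- The set `A` together with the leaves of those vertices labelled `Z` that lie in the odd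
neighbourhood of `A`. Adding these leaves takes their vertices out of the odd neighbourhood. -/
noncomputable def extendSet [Fintype D.LeafBase] (A : Finset V) : Finset (V ⊕ D.LeafBase) :=
  open Classical in
  A.disjSum (Finset.univ.filter fun s => D.label s = .Z ∧ s.1 ∈ D.oddNbhd A)

@[simp]
theorem inl_mem_extendSet [Fintype D.LeafBase] (A : Finset V) (v : V) :
    Sum.inl v ∈ D.extendSet A ↔ v ∈ A := by
  simp [extendSet]

@[simp]
theorem inr_mem_extendSet [Fintype D.LeafBase] (A : Finset V) (s : D.LeafBase) :
    Sum.inr s ∈ D.extendSet A ↔ D.label s = .Z ∧ s.1 ∈ D.oddNbhd A := by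
  simp [extendSet]

/-- The neighbours of an old vertex in the new graph are its old neighbours and its leaf, so a set
of leaves toggles the membership of their vertices in the odd neighbourhood. -/
theorem inl_mem_oddNbhd_disjSum (A : Finset V) (B : Finset D.LeafBase) (v : V) :
    Sum.inl v ∈ D.addLeaves.oddNbhd (A.disjSum B) ↔
      ¬ (v ∈ D.oddNbhd A ↔ ∃ s ∈ B, s.1 = v) := by
  classical
  simp only [oddNbhd, Set.mem_ofPred_eq]
  have hfilter : (A.disjSum B).filter (fun w => D.addLeaves.graph.Adj (.inl v) w) =
      (A.filter fun w => D.graph.Adj v w).disjSum (B.filter fun s => s.1 = v) := by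
    ext (w | s)
    · simp only [Finset.mem_filter, Finset.inl_mem_disjSum]
      rfl
    · simp only [Finset.mem_filter, Finset.inr_mem_disjSum, eq_comm (b := v)]
      rfl
  have hcard : Odd (B.filter fun s => s.1 = v).card ↔ ∃ s ∈ B, s.1 = v := by
    constructor
    · intro h
      obtain ⟨s, hs⟩ := Finset.card_pos.1 h.pos
      exact ⟨s, by simpa using hs⟩
    · rintro ⟨s, hs, rfl⟩
      rw [show B.filter (fun t => t.1 = s.1) = {s} by ext t; simp [Subtype.ext_iff.symm]; aesop]
      simp
  rw [hfilter, Finset.card_disjSum, Nat.odd_add, ← Nat.not_odd_iff_even, hcard]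
  have key : ∀ a b : Prop, (a ↔ ¬ b) ↔ ¬ (a ↔ b) := by tauto
  exact key _ _

@[simp]
theorem inr_mem_oddNbhd_addLeaves (C : Finset (V ⊕ D.LeafBase)) (s : D.LeafBase) :
    Sum.inr s ∈ D.addLeaves.oddNbhd C ↔ Sum.inl s.1 ∈ C := by
  classical
  simp only [oddNbhd, Set.mem_ofPred_eq]
  have hfilter : C.filter (fun w => D.addLeaves.graph.Adj (.inr s) w) =
      C.filter fun w => w = .inl s.1 := by
    refine Finset.filter_congr ?_
    rintro (w | t) - <;> simp [addLeaves, leafGraph]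
  rw [hfilter, Finset.filter_eq']
  split_ifs with h <;> simp [h]

@[simp]
theorem inl_mem_oddNbhd_singleton_leaf (v : V) (s : D.LeafBase) :
    Sum.inl v ∈ D.addLeaves.oddNbhd {.inr s} ↔ v = s := by
  have h := D.inl_mem_oddNbhd_disjSum ∅ {s} v
  rw [show (∅ : Finset V).disjSum {s} = {.inr s} by ext (_ | _) <;> simp] at h
  rw [h]
  simp [oddNbhd, eq_comm]

@[simp]
theorem inl_mem_oddNbhd_extendSet [Fintype D.LeafBase] (A : Finset V) (v : V) :
    Sum.inl v ∈ D.addLeaves.oddNbhd (D.extendSet A) ↔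
      v ∈ D.oddNbhd A ∧ ¬ D.HasLabel v .Z := by
  rw [extendSet, inl_mem_oddNbhd_disjSum]
  simp only [Finset.mem_filter, Finset.mem_univ, true_and, Subtype.exists, HasLabel, NeedsLeaf]
  constructor
  · intro h
    by_cases hv : v ∈ D.oddNbhd A
    · refine ⟨hv, fun hz => h (iff_of_true hv ⟨v, ⟨hz.1, ?_⟩, ⟨hz.2, hv⟩, rfl⟩)⟩
      exact .inr (.inr hz.2)
    · refine (h (iff_of_false hv ?_)).elim
      rintro ⟨_, -, ⟨-, hv'⟩, rfl⟩
      exact hv hv'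
  · rintro ⟨hv, hz⟩ h
    obtain ⟨_, ⟨ho, -⟩, ⟨hl, -⟩, rfl⟩ := h.1 hv
    exact hz ⟨ho, hl⟩

open Classical in
/-- The correction sets of the diagram with leaves: a vertex with a leaf is corrected by that leaf
alone, and the leaf takes over the correction set of the vertex. -/
noncomputable def leafCorrection [Fintype D.LeafBase] (p : V → Finset V) :
    V ⊕ D.LeafBase → Finset (V ⊕ D.LeafBase)
  | .inl v => if hv : v ∉ D.outputs ∧ (D.label v).NeedsLeaf then {.inr ⟨v, hv⟩}
      else D.extendSet (p v)
  | .inr s => D.extendSet (p s)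

/-- The order of the diagram with leaves, in which a leaf comes immediately after its vertex. -/
inductive LeafPrec (prec : V → V → Prop) : V ⊕ D.LeafBase → V ⊕ D.LeafBase → Prop
  | base {x y : V ⊕ D.LeafBase} :
    prec (x.elim id Subtype.val) (y.elim id Subtype.val) → LeafPrec prec x y
  | leaf (s : D.LeafBase) : LeafPrec prec (.inl s.1) (.inr s)

variable {D}

theorem LeafPrec.trans {prec : V → V → Prop} (h : ∀ u v w, prec u v → prec v w → prec u w)
    {x y z : V ⊕ D.LeafBase} (hxy : D.LeafPrec prec x y) (hyz : D.LeafPrec prec y z) :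
    D.LeafPrec prec x z := by
  cases hxy with
  | base hxy =>
    cases hyz with
    | base hyz => exact .base (h _ _ _ hxy hyz)
    | leaf s => exact .base hxy
  | leaf s =>
    cases hyz with
    | base hyz => exact .base hyz

theorem LeafPrec.irrefl {prec : V → V → Prop} (h : ∀ u, ¬ prec u u) (x : V ⊕ D.LeafBase) :
    ¬ D.LeafPrec prec x x := by
  rintro ⟨hx⟩
  exact h _ hx

/-- The set `D.extendSet (p w)` satisfies the first three flow conditions at every vertex other than
`w` and the leaf of `w`. -/
theorem IsPauliFlow.extendSet_of_ne [Fintype D.LeafBase] {p : V → Finset V}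
    {prec : V → V → Prop} (h : D.IsPauliFlow p prec) {w : V} (hw : w ∉ D.outputs)
    (y : V ⊕ D.LeafBase) (hne : y.elim id Subtype.val ≠ w) :
    (y ∈ D.extendSet (p w) → ¬ (D.addLeaves.HasLabel y .X ∨ D.addLeaves.HasLabel y .Y) →
      prec w (y.elim id Subtype.val)) ∧
    (y ∈ D.addLeaves.oddNbhd (D.extendSet (p w)) →
      ¬ (D.addLeaves.HasLabel y .Y ∨ D.addLeaves.HasLabel y .Z) →
      prec w (y.elim id Subtype.val)) ∧
    (¬ prec w (y.elim id Subtype.val) → D.addLeaves.HasLabel y .Y →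
      (y ∈ D.extendSet (p w) ↔ y ∈ D.addLeaves.oddNbhd (D.extendSet (p w)))) := by
  have h1 := fun hm => h.cond1 w hw _ hm hne
  have h2 := fun hm => h.cond2 w hw _ hm hne
  have h3 := fun hn => h.cond3 w hw _ hn hne.symm
  rcases y with v | ⟨v, hv, hl⟩
  · by_cases hv : v ∈ D.outputs
    · simp_all [HasLabel]
    · cases hl : D.label v <;> simp_all [HasLabel, spiderLabel]
      -- What remains is a vertex whose label changes from `XZ` to `Y`: if it does not come after
      -- `w`, then it is in neither of the two sets.
      tauto
  · rcases hl with hl | hl | hl <;> simp_all [HasLabel, leafLabel]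

/-- What is needed for the leaf of `w` to be corrected by `D.extendSet (p w)` although `w` precedes
its leaf: the new label of `w` is Pauli, `w` lies in the correction set, and `w` lies in the odd
neighbourhood exactly if its label is `Y`. -/
theorem IsPauliFlow.extendSet_self [Fintype D.LeafBase] {p : V → Finset V}
    {prec : V → V → Prop} (h : D.IsPauliFlow p prec) {w : V} (hw : w ∉ D.outputs)
    (hl : (D.label w).NeedsLeaf) :
    w ∈ p w ∧ (D.addLeaves.HasLabel (.inl w) .X ∨ D.addLeaves.HasLabel (.inl w) .Y) ∧
    (Sum.inl w ∈ D.addLeaves.oddNbhd (D.extendSet (p w)) ↔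
      D.addLeaves.HasLabel (.inl w) .Y) := by
  have h5 := h.cond5 w
  have h6 := h.cond6 w
  have h8 := h.cond8 w
  rcases hl with hl | hl | hl <;> simp_all [HasLabel, spiderLabel]

theorem leafCorrection_of_needsLeaf [Fintype D.LeafBase] (p : V → Finset V) {v : V}
    (hv : v ∉ D.outputs ∧ (D.label v).NeedsLeaf) :
    D.leafCorrection p (.inl v) = {.inr ⟨v, hv⟩} := dif_pos hv

theorem leafCorrection_of_not_needsLeaf [Fintype D.LeafBase] (p : V → Finset V) {v : V}
    (hv : ¬ (D.label v).NeedsLeaf) : D.leafCorrection p (.inl v) = D.extendSet (p v) :=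
  dif_neg fun h => hv h.2

theorem leafCorrection_inr [Fintype D.LeafBase] (p : V → Finset V) (s : D.LeafBase) :
    D.leafCorrection p (.inr s) = D.extendSet (p s) := rfl

/-- The flow conditions for the labels `X`, `Y` and `XY` at the corrected vertex. -/
theorem IsPauliFlow.leafCorrection_self [Fintype D.LeafBase] {p : V → Finset V}
    {prec : V → V → Prop} (h : D.IsPauliFlow p prec) (u : V ⊕ D.LeafBase) :
    (D.addLeaves.HasLabel u .XY → u ∉ D.leafCorrection p u ∧
      u ∈ D.addLeaves.oddNbhd (D.leafCorrection p u)) ∧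
    (D.addLeaves.HasLabel u .X → u ∈ D.addLeaves.oddNbhd (D.leafCorrection p u)) ∧
    (D.addLeaves.HasLabel u .Y →
      (u ∈ D.leafCorrection p u ∧ u ∉ D.addLeaves.oddNbhd (D.leafCorrection p u)) ∨
      (u ∉ D.leafCorrection p u ∧ u ∈ D.addLeaves.oddNbhd (D.leafCorrection p u))) := by
  rcases u with u | s
  · by_cases hu : u ∈ D.outputs
    · simp [hu]
    by_cases hl : (D.label u).NeedsLeaf
    · rw [leafCorrection_of_needsLeaf p ⟨hu, hl⟩]
      rcases hl with hl | hl | hl <;> simp [hl, spiderLabel]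
    · rw [leafCorrection_of_not_needsLeaf p hl]
      have h4 := h.cond4 u
      have h7 := h.cond7 u
      have h9 := h.cond9 u
      cases hl' : D.label u <;> simp_all [HasLabel, spiderLabel, NeedsLeaf]
  · obtain ⟨hp, -⟩ := h.extendSet_self s.2.1 s.2.2
    rw [leafCorrection_inr]
    rcases s with ⟨u, hu, hl⟩
    rcases hl with hl | hl | hl <;> simp_all [leafLabel]

theorem IsPauliFlow.addLeaves [Fintype D.LeafBase] {p : V → Finset V}
    {prec : V → V → Prop} (h : D.IsPauliFlow p prec) :
    D.addLeaves.IsPauliFlow (D.leafCorrection p) (D.LeafPrec prec) := by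
  have hlabel : ∀ s : D.LeafBase, D.addLeaves.HasLabel (.inr s) .X ∨
      D.addLeaves.HasLabel (.inr s) .XY := by
    intro s
    cases hl : D.label s <;> simp [hl, leafLabel]
  -- The conditions at a vertex other than the corrected one.
  have hother : ∀ u, u ∉ D.addLeaves.outputs → ∀ v, v ≠ u →
      (v ∈ D.leafCorrection p u →
        ¬ (D.addLeaves.HasLabel v .X ∨ D.addLeaves.HasLabel v .Y) → D.LeafPrec prec u v) ∧
      (v ∈ D.addLeaves.oddNbhd (D.leafCorrection p u) →
        ¬ (D.addLeaves.HasLabel v .Y ∨ D.addLeaves.HasLabel v .Z) → D.LeafPrec prec u v) ∧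
      (¬ D.LeafPrec prec u v → D.addLeaves.HasLabel v .Y →
        (v ∈ D.leafCorrection p u ↔ v ∈ D.addLeaves.oddNbhd (D.leafCorrection p u))) := by
    rintro (u | s) hu v hne
    · rw [inl_mem_outputs_addLeaves] at hu
      by_cases hl : (D.label u).NeedsLeaf
      · rw [leafCorrection_of_needsLeaf p ⟨hu, hl⟩]
        rcases v with v | t
        · have : v ≠ u := fun h => hne (by rw [h])
          simp [this]
        · refine ⟨fun ht _ => ?_, by simp, fun _ hY => ?_⟩
          · rw [Finset.mem_singleton.1 ht]
            exact .leaf ⟨u, hu, hl⟩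
          · rcases hlabel t with hX | hX <;> cases hX.2.symm.trans hY.2
      · rw [leafCorrection_of_not_needsLeaf p hl]
        have hne' : v.elim id Subtype.val ≠ u := by
          rintro rfl
          rcases v with v | t
          exacts [hne rfl, hl t.2.2]
        obtain ⟨h1, h2, h3⟩ := h.extendSet_of_ne hu v hne'
        exact ⟨fun a b => .base (h1 a b), fun a b => .base (h2 a b),
          fun a b => h3 (fun c => a (.base c)) b⟩
    · rw [leafCorrection_inr]
      by_cases hne' : v.elim id Subtype.val = s
      · rcases v with v | t
        · obtain rfl : v = s := hne'
          obtain ⟨hp, hXY, hodd⟩ := h.extendSet_self s.2.1 s.2.2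
          refine ⟨fun _ hn => absurd hXY hn, fun ho hn => absurd (.inl (hodd.1 ho)) hn,
            fun _ hY => iff_of_true ?_ (hodd.2 hY)⟩
          rwa [inl_mem_extendSet]
        · exact absurd (congrArg Sum.inr (Subtype.ext hne')) hne
      · obtain ⟨h1, h2, h3⟩ := h.extendSet_of_ne s.2.1 v hne'
        exact ⟨fun a b => .base (h1 a b), fun a b => .base (h2 a b),
          fun a b => h3 (fun c => a (.base c)) b⟩
  have hlabels : ∀ v l, D.addLeaves.HasLabel v l → l = .X ∨ l = .Y ∨ l = .XY := fun v l hv =>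
    hv.2 ▸ D.label_addLeaves v
  exact {
    irrefl := LeafPrec.irrefl h.irrefl
    trans := fun _ _ _ => LeafPrec.trans h.trans
    not_input := by
      have key : ∀ w, w ∉ D.outputs → ∀ v ∈ D.extendSet (p w), v ∉ D.addLeaves.inputs := by
        rintro w hw (v | t) hv
        · rw [inl_mem_extendSet] at hv
          rw [inl_mem_inputs_addLeaves]
          exact h.not_input w hw v hv
        · exact D.inr_notMem_inputs_addLeaves t
      rintro (u | s) hu
      · rw [inl_mem_outputs_addLeaves] at hu
        by_cases hl : (D.label u).NeedsLeaf
        · rw [leafCorrection_of_needsLeaf p ⟨hu, hl⟩]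
          simp
        · rw [leafCorrection_of_not_needsLeaf p hl]
          exact key u hu
      · exact key s s.2.1
    cond1 := fun u hu v hm hne => (hother u hu v hne).1 hm
    cond2 := fun u hu v hm hne => (hother u hu v hne).2.1 hm
    cond3 := fun u hu v hn hne => (hother u hu v hne.symm).2.2 hn
    cond4 := fun u => (h.leafCorrection_self u).1
    cond5 := fun u hu => by simpa using hlabels u _ hu
    cond6 := fun u hu => by simpa using hlabels u _ hu
    cond7 := fun u => (h.leafCorrection_self u).2.1
    cond8 := fun u hu => by simpa using hlabels u _ hu
    cond9 := fun u => (h.leafCorrection_self u).2.2 }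

end Flow

end MBQCDiagram

theorem proposition3p3 {V : Type*} [Fintype V] {n m : ℕ} (D : MBQCDiagram V n m)
    (hD : D.HasPauliFlow) :
    ∃ (k : ℕ) (D' : MBQCDiagram (Fin k) n m),
      D.Equivalent D' ∧ D'.HasPauliFlow ∧
      ∀ v, v ∉ D'.outputs → D'.label v = .X ∨ D'.label v = .Y ∨ D'.label v = .XY := by
  classical
  obtain ⟨p, prec, h⟩ := hD
  let e := Fintype.equivFin (V ⊕ D.LeafBase)
  have hflow : D.addLeaves.HasPauliFlow := ⟨_, _, h.addLeaves⟩
  exact ⟨_, D.addLeaves.reindex e, D.equivalent_addLeaves.trans (D.addLeaves.equivalent_reindex e),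
    hflow.reindex e, fun v _ => D.label_addLeaves (e.symm v)⟩
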